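/- For $s\in\mathbb R$ and an integer $n\ge 0$ let $(s)_n=\prod_{k=0}^{n-1}(s+k)$ denote the Pochhammer symbol, with $(s)_0=1$. Then the following two series converge (absolutely), with the indicated sums: $$\sum_{n=0}^{\infty}\frac{(\frac12)_n^3}{n!^3}\,(1+6n)\,\frac{1}{2^{2n}}=\frac{4}{\pi}$$ and $$\sum_{n=0}^{\infty}\frac{(\frac12)_n^3}{n!^3}\,\frac{1}{4^{n}}=\frac{2\sqrt[3]{2}}{3}\,\frac{\sqrt{\pi}}{\Gamma(\frac56)^3}.$$ -/

import Mathlib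

open Filter Topology Finset

/-! Each series is the case k = 0 of a family whose sum satisfies a first-order recurrence in k and
whose normalised sum tends to 1 as k → ∞; the product of the recurrence factors then gives the value
at k = 0. For 4/π the sum of `balancedTerm k n * (6n + 4k + 1)` gains the factor (k+1)²/(k+1/2)²
under k → k+1 (`tsum_balancedTerm_add_one`), and Wallis' product evaluates the limit. For the second
series the sum of `cubicTerm k` satisfies a recurrence under k → k+3 (`tsum_cubicTerm_add_three`).
Iterating from k = 0 gives Euler's limits for Γ at multiples of 1/12, which reflection and
duplication reduce to Γ(5/6). Both recurrences come from explicit telescoping certificates. -/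

/-- The terms of `₃F₂(1/2, 1/2, 1/2; k + 1, k + 1; 1/4)`. -/
noncomputable def balancedTerm (k : ℝ) (n : ℕ) : ℝ :=
  ∏ i ∈ range n, (1 / 2 + i : ℝ) ^ 3 / (4 * (k + 1 + i) ^ 2 * (1 + i))

/-- The terms of `₃F₂(2k + 1/2, 1/2, 1/2; k + 1, k + 1; 1/4)`. -/
noncomputable def cubicTerm (k : ℝ) (n : ℕ) : ℝ :=
  ∏ i ∈ range n, (2 * k + 1 / 2 + i) * (1 / 2 + i : ℝ) ^ 2 / (4 * (k + 1 + i) ^ 2 * (1 + i))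

/-! ### Recurrences, geometric bounds and limits for large k -/

theorem balancedTerm_zero (k : ℝ) : balancedTerm k 0 = 1 := by simp [balancedTerm]

theorem cubicTerm_zero (k : ℝ) : cubicTerm k 0 = 1 := by simp [cubicTerm]

theorem balancedTerm_succ (k : ℝ) (n : ℕ) :
    balancedTerm k (n + 1) =
      balancedTerm k n * ((1 / 2 + n : ℝ) ^ 3 / (4 * (k + 1 + n) ^ 2 * (1 + n))) :=
  prod_range_succ _ _

theorem cubicTerm_succ (k : ℝ) (n : ℕ) :
    cubicTerm k (n + 1) = cubicTerm k n *
      ((2 * k + 1 / 2 + n) * (1 / 2 + n : ℝ) ^ 2 / (4 * (k + 1 + n) ^ 2 * (1 + n))) :=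
  prod_range_succ _ _

theorem cubicTerm_zero_left (n : ℕ) : cubicTerm 0 n = balancedTerm 0 n := by
  refine prod_congr rfl fun i _ => ?_
  ring

theorem balancedTerm_zero_left (n : ℕ) :
    balancedTerm 0 n =
      ((ascPochhammer ℝ n).eval (1 / 2 : ℝ)) ^ 3 / (Nat.factorial n : ℝ) ^ 3 * (1 / 4 ^ n) := by
  induction n with
  | zero => simp [balancedTerm]
  | succ n ih =>
    rw [balancedTerm_succ, ih, ascPochhammer_succ_eval, Nat.factorial_succ]
    have : (Nat.factorial n : ℝ) ≠ 0 := by positivity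
    push_cast
    field_simp
    ring

theorem balancedTerm_nonneg {k : ℝ} (hk : 0 ≤ k) (n : ℕ) : 0 ≤ balancedTerm k n :=
  prod_nonneg fun i _ => by positivity

theorem cubicTerm_nonneg {k : ℝ} (hk : 0 ≤ k) (n : ℕ) : 0 ≤ cubicTerm k n :=
  prod_nonneg fun i _ => by positivity

theorem cubicRatio_le {k : ℝ} (hk : 0 ≤ k) (n : ℕ) :
    (2 * k + 1 / 2 + n) * (1 / 2 + n : ℝ) ^ 2 / (4 * (k + 1 + n) ^ 2 * (1 + n)) ≤ 1 / 2 := by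
  rw [div_le_iff₀ (by positivity)]
  have h1 : 2 * k + 1 / 2 + n ≤ 2 * (k + 1 + n) := by
    have : (0 : ℝ) ≤ n := by positivity
    linarith
  have h2 : (1 / 2 + n : ℝ) ≤ k + 1 + n := by linarith
  have h3 : (1 / 2 + n : ℝ) ≤ 1 + n := by linarith
  calc (2 * k + 1 / 2 + n) * (1 / 2 + n : ℝ) ^ 2
      = (2 * k + 1 / 2 + n) * ((1 / 2 + n) * (1 / 2 + n)) := by ring
    _ ≤ (2 * (k + 1 + n)) * ((k + 1 + n) * (1 + n)) := by gcongr
    _ = _ := by ring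

/-- The factor at index 0 is already at most 1/(k+1), and each later one is at most 1/2. The decay
in k makes the tail of the series vanish as k → ∞. -/
theorem cubicTerm_succ_le {k : ℝ} (hk : 0 ≤ k) (n : ℕ) :
    cubicTerm k (n + 1) ≤ (1 / 2) ^ n / (k + 1) := by
  induction n with
  | zero =>
    rw [cubicTerm_succ, cubicTerm_zero, Nat.cast_zero, one_mul, pow_zero,
      div_le_div_iff₀ (by positivity) (by positivity)]
    nlinarith
  | succ n ih =>
    rw [cubicTerm_succ]
    calc _ ≤ (1 / 2) ^ n / (k + 1) * (1 / 2) :=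
          mul_le_mul ih (cubicRatio_le hk _) (by positivity) (by positivity)
      _ = _ := by ring

theorem cubicTerm_le {k : ℝ} (hk : 0 ≤ k) (n : ℕ) : cubicTerm k n ≤ (1 / 2) ^ n := by
  induction n with
  | zero => simp [cubicTerm]
  | succ n ih =>
    rw [cubicTerm_succ, pow_succ _ n]
    exact mul_le_mul ih (cubicRatio_le hk _) (by positivity) (by positivity)

theorem balancedTerm_le_cubicTerm {k : ℝ} (hk : 0 ≤ k) (n : ℕ) :
    balancedTerm k n ≤ cubicTerm k n := by
  refine prod_le_prod (fun i _ => by positivity) fun i _ => ?_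
  gcongr
  calc (1 / 2 + i : ℝ) ^ 3 = (1 / 2 + i) * (1 / 2 + i) ^ 2 := by ring
    _ ≤ (2 * k + 1 / 2 + i) * (1 / 2 + i) ^ 2 := by gcongr; linarith

theorem summable_cubicTerm {k : ℝ} (hk : 0 ≤ k) : Summable (cubicTerm k) :=
  Summable.of_nonneg_of_le (cubicTerm_nonneg hk) (cubicTerm_le hk) summable_geometric_two

theorem summable_pow_mul_half_pow (d : ℕ) : Summable fun n : ℕ => (n : ℝ) ^ d * (1 / 2) ^ n :=
  summable_pow_mul_geometric_of_norm_lt_one d (by norm_num)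

theorem summable_balancedTerm_mul {k : ℝ} (hk : 0 ≤ k) :
    Summable fun n : ℕ => balancedTerm k n * (6 * n + 4 * k + 1) := by
  refine Summable.of_nonneg_of_le
    (fun n => mul_nonneg (balancedTerm_nonneg hk n) (by positivity))
    (fun n => mul_le_mul_of_nonneg_right
      ((balancedTerm_le_cubicTerm hk n).trans (cubicTerm_le hk n)) (by positivity)) ?_
  refine (((summable_pow_mul_half_pow 1).mul_left 6).add
    ((summable_pow_mul_half_pow 0).mul_left (4 * k + 1))).congr fun n => ?_
  ring

/-- A sequence of series with leading term `1` and tails `O(1 / j)` has sums tending to `1`. -/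
theorem tendsto_tsum_one_of_tail_le {f : ℕ → ℕ → ℝ} {b : ℕ → ℝ} (hb : Summable b)
    (h0 : ∀ j, f j 0 = 1) (hf : ∀ j n, 0 ≤ f j n)
    (hle : ∀ j n, f j (n + 1) ≤ b n / (j + 1)) :
    Tendsto (fun j => ∑' n, f j n) atTop (𝓝 1) := by
  have hs : ∀ j, Summable fun n => f j (n + 1) := fun j =>
    Summable.of_nonneg_of_le (fun n => hf j _) (hle j) (hb.div_const _)
  have hlim : Tendsto (fun j : ℕ => 1 + (∑' n, b n) / ((j : ℝ) + 1)) atTop (𝓝 1) := by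
    have := (tendsto_one_div_add_atTop_nhds_zero_nat (𝕜 := ℝ)).const_mul (∑' n, b n)
    simpa [div_eq_mul_inv] using this.const_add 1
  have hsplit : ∀ j, ∑' n, f j n = 1 + ∑' n, f j (n + 1) := fun j => by
    rw [((summable_nat_add_iff 1).1 (hs j)).tsum_eq_zero_add, h0]
  refine tendsto_of_tendsto_of_tendsto_of_le_of_le tendsto_const_nhds hlim (fun j => ?_)
    fun j => ?_
  · simpa only [hsplit j, le_add_iff_nonneg_right] using tsum_nonneg fun n => hf j (n + 1)
  · simp only [hsplit j, ← tsum_div_const]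
    gcongr
    · exact hs j
    · exact hb.div_const _
    · exact hle j _

theorem tendsto_tsum_cubicTerm (a : ℕ → ℝ) (ha : ∀ j : ℕ, (j : ℝ) ≤ a j) :
    Tendsto (fun j => ∑' n, cubicTerm (a j) n) atTop (𝓝 1) := by
  have h0 : ∀ j, 0 ≤ a j := fun j => (Nat.cast_nonneg j).trans (ha j)
  refine tendsto_tsum_one_of_tail_le summable_geometric_two (fun j => cubicTerm_zero _)
    (fun j => cubicTerm_nonneg (h0 j)) fun j n => (cubicTerm_succ_le (h0 j) n).trans ?_
  gcongr
  exact ha j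

theorem tendsto_tsum_balancedTerm :
    Tendsto (fun j : ℕ => ∑' n : ℕ, balancedTerm j n * (6 * n + 4 * j + 1) / (4 * j + 1))
      atTop (𝓝 1) := by
  have hb : Summable fun n : ℕ => (1 / 2 : ℝ) ^ n * (6 * n + 7) := by
    refine (((summable_pow_mul_half_pow 1).mul_left 6).add
      ((summable_pow_mul_half_pow 0).mul_left 7)).congr fun n => ?_
    ring
  refine tendsto_tsum_one_of_tail_le hb (fun j => ?_) (fun j n => ?_) fun j n => ?_
  · have : (4 * j + 1 : ℝ) ≠ 0 := by positivity
    simp [balancedTerm_zero, this]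
  · exact div_nonneg (mul_nonneg (balancedTerm_nonneg (by positivity) n) (by positivity))
      (by positivity)
  · have hj : (0 : ℝ) ≤ j := by positivity
    have hn : (0 : ℝ) ≤ n := by positivity
    have h1 := (balancedTerm_le_cubicTerm hj (n + 1)).trans (cubicTerm_succ_le hj n)
    have h2 : (6 * ((n + 1 : ℕ) : ℝ) + 4 * j + 1) / (4 * j + 1) ≤ 6 * n + 7 := by
      rw [div_le_iff₀ (by positivity)]
      push_cast
      nlinarith [mul_nonneg hj hn]
    rw [mul_div_assoc]
    calc _ ≤ (1 / 2) ^ n / ((j : ℝ) + 1) * (6 * n + 7) :=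
          mul_le_mul h1 h2 (by positivity) (by positivity)
      _ = _ := by ring

/-! ### The series for 4/π: shift by one and Wallis' product -/

theorem balancedTerm_add_one {k : ℝ} (hk : 0 ≤ k) (n : ℕ) :
    balancedTerm (k + 1) n = balancedTerm k n * ((k + 1) ^ 2 / (k + 1 + n) ^ 2) := by
  induction n with
  | zero =>
    have : k + 1 ≠ 0 := by positivity
    simp [balancedTerm, this]
  | succ n ih =>
    rw [balancedTerm_succ, balancedTerm_succ, ih]
    push_cast
    have h1 : k + 1 + n ≠ 0 := by positivity
    have h2 : k + 1 + (n + 1) ≠ 0 := by positivity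
    have h3 : k + 1 + 1 + n ≠ 0 := by positivity
    field_simp
    ring

/-- After `balancedTerm_add_one` both terms are rational multiples of `balancedTerm k n`, and 8n is
the certificate that makes their combination a difference in n. -/
theorem balancedTerm_telescope {k : ℝ} (hk : 0 ≤ k) (N : ℕ) :
    ∑ n ∈ range N, ((k + 1 / 2) ^ 2 * (balancedTerm (k + 1) n * (6 * n + 4 * (k + 1) + 1))
      - (k + 1) ^ 2 * (balancedTerm k n * (6 * n + 4 * k + 1)))
      = (k + 1) ^ 2 * (8 * N * balancedTerm k N) := by
  induction N with
  | zero => simp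
  | succ n ih =>
    rw [sum_range_succ, ih, balancedTerm_succ, balancedTerm_add_one hk]
    have h1 : k + 1 + n ≠ 0 := by positivity
    push_cast
    field_simp
    ring

theorem tsum_balancedTerm_add_one {k : ℝ} (hk : 0 ≤ k) :
    (k + 1 / 2) ^ 2 * ∑' n : ℕ, balancedTerm (k + 1) n * (6 * n + 4 * (k + 1) + 1)
      = (k + 1) ^ 2 * ∑' n : ℕ, balancedTerm k n * (6 * n + 4 * k + 1) := by
  have h := (((summable_balancedTerm_mul (k := k + 1) (by positivity)).hasSum.mul_left
    ((k + 1 / 2) ^ 2)).sub ((summable_balancedTerm_mul hk).hasSum.mul_left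
    ((k + 1) ^ 2))).tendsto_sum_nat
  simp only [balancedTerm_telescope hk] at h
  have h0 : Tendsto (fun N : ℕ => (k + 1) ^ 2 * (8 * N * balancedTerm k N)) atTop (𝓝 0) := by
    have h1 := ((summable_pow_mul_half_pow 1).tendsto_atTop_zero).const_mul ((k + 1) ^ 2 * 8)
    rw [mul_zero] at h1
    refine squeeze_zero (fun N => ?_) (fun N => ?_) h1
    · exact mul_nonneg (by positivity) (mul_nonneg (by positivity) (balancedTerm_nonneg hk N))
    · have h2 := (balancedTerm_le_cubicTerm hk N).trans (cubicTerm_le hk N)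
      calc (k + 1) ^ 2 * (8 * N * balancedTerm k N)
          ≤ (k + 1) ^ 2 * (8 * N * (1 / 2) ^ N) := by gcongr
        _ = _ := by ring
  exact sub_eq_zero.1 (tendsto_nhds_unique h h0)

/-- The recurrence factor (2k+2)²/(2k+1)² is the Wallis factor times (2k+3)/(2k+1), and the latter
telescopes. -/
theorem tsum_balancedTerm_eq_mul_wallis (k : ℕ) :
    ∑' n : ℕ, balancedTerm k n * (6 * n + 4 * k + 1) =
      (∑' n : ℕ, balancedTerm 0 n * (6 * n + 1)) * (Real.Wallis.W k * (2 * k + 1)) := by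
  induction k with
  | zero => simp [Real.Wallis.W]
  | succ k ih =>
    have h := tsum_balancedTerm_add_one (k := (k : ℝ)) (by positivity)
    have h1 : (k + 1 / 2 : ℝ) ^ 2 ≠ 0 := by positivity
    push_cast
    rw [Real.Wallis.W_succ]
    rw [ih] at h
    refine mul_left_cancel₀ h1 (h.trans ?_)
    have h2 : (2 * k + 1 : ℝ) ≠ 0 := by positivity
    have h3 : (2 * k + 3 : ℝ) ≠ 0 := by positivity
    field_simp
    ring

theorem tsum_balancedTerm_zero : ∑' n : ℕ, balancedTerm 0 n * (6 * n + 1) = 4 / Real.pi := by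
  have h1 : Tendsto (fun k : ℕ => (4 * k + 1 : ℝ) / (2 * k + 1)) atTop (𝓝 2) := by
    have h := (tendsto_one_div_add_atTop_nhds_zero_nat (𝕜 := ℝ))
    have h2 : Tendsto (fun k : ℕ => 1 / ((2 * k : ℝ) + 1)) atTop (𝓝 0) := by
      refine squeeze_zero (fun k => by positivity) (fun k => ?_) h
      gcongr
      have : (0 : ℝ) ≤ k := by positivity
      linarith
    have h3 := h2.const_sub 2
    rw [sub_zero] at h3
    refine h3.congr fun k => ?_
    field_simp
    ring
  have h2 := h1.mul tendsto_tsum_balancedTerm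
  have h3 := Real.Wallis.tendsto_W_nhds_pi_div_two.const_mul
    (∑' n : ℕ, balancedTerm 0 n * (6 * n + 1))
  have h4 := tendsto_nhds_unique h3 (h2.congr fun k => ?_)
  · have := Real.pi_ne_zero
    field_simp at h4 ⊢
    linarith
  · rw [tsum_div_const, tsum_balancedTerm_eq_mul_wallis]
    have h5 : (4 * k + 1 : ℝ) ≠ 0 := by positivity
    have h6 : (2 * k + 1 : ℝ) ≠ 0 := by positivity
    field_simp

/-! ### The gamma series: shift by three and Euler's limit -/

/-- The polynomial factor of the Zeilberger certificate for the shift of `k` by `3`. -/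
noncomputable def cubicCertificate (k n : ℝ) : ℝ :=
  (-55 / 2 + 2956 * k + 9194 * k ^ 2 + 9992 * k ^ 3 + 4608 * k ^ 4 + 768 * k ^ 5)
    + (387 + 6260 * k + 12092 * k ^ 2 + 7968 * k ^ 3 + 1728 * k ^ 4) * n
    + (438 + 3712 * k + 4280 * k ^ 2 + 1312 * k ^ 3) * n ^ 2
    + (116 + 656 * k + 336 * k ^ 2) * n ^ 3

/-- The sixth Pochhammer symbol at `x`. -/
noncomputable def risingSix (x : ℝ) : ℝ :=
  x * (x + 1) * (x + 2) * (x + 3) * (x + 4) * (x + 5)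

/-- The third Pochhammer symbol at `x`. -/
noncomputable def risingThree (x : ℝ) : ℝ := x * (x + 1) * (x + 2)

theorem risingSix_pos {x : ℝ} (hx : 0 < x) : 0 < risingSix x := by
  unfold risingSix; positivity

theorem risingThree_pos {x : ℝ} (hx : 0 < x) : 0 < risingThree x := by
  unfold risingThree; positivity

/-- With a = 2k + 1/2 the shift moves a by 6 and k+1 by 3, so (a)₆ (a+6)ₙ = (a)ₙ (a+n)₆, and
similarly for the denominators. -/
theorem cubicTerm_add_three {k : ℝ} (hk : 0 ≤ k) (n : ℕ) :
    risingSix (2 * k + 1 / 2) * cubicTerm (k + 3) n = cubicTerm k n *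
      (risingSix (2 * k + 1 / 2 + n) * risingThree (k + 1) ^ 2 / risingThree (k + 1 + n) ^ 2) := by
  induction n with
  | zero =>
    have : risingThree (k + 1) ≠ 0 := (risingThree_pos (by positivity)).ne'
    simp [cubicTerm]
    field_simp
  | succ n ih =>
    rw [cubicTerm_succ, cubicTerm_succ, ← mul_assoc, ih]
    push_cast
    have e6 : risingSix (2 * k + 1 / 2 + (n + 1)) * (2 * k + 1 / 2 + n)
        = risingSix (2 * k + 1 / 2 + n) * (2 * (k + 3) + 1 / 2 + n) := by
      unfold risingSix; ring
    have e3 : risingThree (k + 1 + (n + 1)) * (k + 1 + n)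
        = risingThree (k + 1 + n) * (k + 3 + 1 + n) := by
      unfold risingThree; ring
    have h1 : k + 1 + n ≠ 0 := by positivity
    have h2 : k + 3 + 1 + n ≠ 0 := by positivity
    have h3 : risingThree (k + 1 + n) ≠ 0 := (risingThree_pos (by positivity)).ne'
    have h4 : risingThree (k + 1 + (n + 1)) ≠ 0 := (risingThree_pos (by positivity)).ne'
    have h5 : (1 + n : ℝ) ≠ 0 := by positivity
    have e3' : risingThree (k + 1 + n)
        = risingThree (k + 1 + (n + 1)) * (k + 1 + n) / (k + 3 + 1 + n) := by
      rw [e3]; field_simp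
    rw [e3']
    generalize risingThree (k + 1 + (n + 1)) = p at *
    generalize risingSix (2 * k + 1 / 2 + (n + 1)) = q at *
    generalize risingSix (2 * k + 1 / 2 + n) = r at *
    generalize risingThree (k + 1) = s at *
    refine (mul_assoc _ _ _).trans (Eq.trans (congrArg _ ?_) (mul_assoc _ _ _).symm)
    rw [div_pow, div_div_eq_mul_div, div_mul_div_comm, div_mul_div_comm, div_eq_div_iff (by positivity) (by positivity)]
    linear_combination (-(s ^ 2 * (k + 3 + 1 + n) ^ 2 * (1 / 2 + n) ^ 2 * (4 * (k + 1 + n) ^ 2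
      * (1 + n)) * p ^ 2)) * e6

/-- This is the induction step of `cubicTerm_telescope` divided by `cubicTerm k n * risingThree (k +
1) ^ 2 / risingThree (k + 1 + n) ^ 2`. -/
theorem cubicCertificate_identity (k n : ℝ) :
    (2 * k + 5) ^ 2 * risingSix (2 * k + 1 / 2 + n)
      - 16 * (4 * k + 1) * (4 * k + 7) * risingThree (k + 1 + n) ^ 2
    = (n + 1 / 2 + 2 * k) * (n + 1 / 2) ^ 2 / 4 * cubicCertificate k (n + 1)
      - n * (k + 3 + n) ^ 2 * cubicCertificate k n := by
  unfold risingSix risingThree cubicCertificate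
  ring

theorem cubicTerm_telescope {k : ℝ} (hk : 0 ≤ k) (N : ℕ) :
    ∑ n ∈ range N, ((2 * k + 5) ^ 2 * risingSix (2 * k + 1 / 2) * cubicTerm (k + 3) n
      - 16 * (4 * k + 1) * (4 * k + 7) * risingThree (k + 1) ^ 2 * cubicTerm k n)
      = risingThree (k + 1) ^ 2 * (N * cubicCertificate k N * cubicTerm k N)
        / ((k + 1 + N) * (k + 2 + N)) ^ 2 := by
  induction N with
  | zero => simp
  | succ n ih =>
    rw [sum_range_succ, ih, cubicTerm_succ, mul_assoc _ (risingSix _), cubicTerm_add_three hk]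
    have h1 : k + 1 + n ≠ 0 := by positivity
    have h2 : k + 2 + n ≠ 0 := by positivity
    have h3 : k + 3 + n ≠ 0 := by positivity
    have h5 : (n + 1 : ℝ) ≠ 0 := by positivity
    have key := cubicCertificate_identity k n
    have er : risingThree (k + 1 + n) = (k + 1 + n) * (k + 2 + n) * (k + 3 + n) := by
      unfold risingThree; ring
    rw [er] at key ⊢
    push_cast
    have e1 : k + 1 + (n + 1) = k + 2 + (n : ℝ) := by ring
    have e2 : k + 2 + (n + 1) = k + 3 + (n : ℝ) := by ring
    have e3 : (1 + n : ℝ) = n + 1 := by ring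
    rw [e1, e2, e3]
    generalize risingSix (2 * k + 1 / 2 + n) = r at *
    generalize risingThree (k + 1) = s at *
    generalize cubicCertificate k (n + 1) = x at *
    generalize cubicCertificate k n = y at *
    generalize cubicTerm k n = t at *
    have hx : (2 * k + 5) ^ 2 * r = 16 * (4 * k + 1) * (4 * k + 7)
        * ((k + 1 + n) * (k + 2 + n) * (k + 3 + n)) ^ 2
        + ((n + 1 / 2 + 2 * k) * (n + 1 / 2) ^ 2 / 4 * x - n * (k + 3 + n) ^ 2 * y) := by
      linarith
    have hl : (2 * k + 5) ^ 2 * (t * (r * s ^ 2 / ((k + 1 + n) * (k + 2 + n) * (k + 3 + n)) ^ 2))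
        = ((2 * k + 5) ^ 2 * r)
          * (t * s ^ 2 / ((k + 1 + n) * (k + 2 + n) * (k + 3 + n)) ^ 2) := by ring
    rw [hl, hx]
    generalize k + 1 + (n : ℝ) = a at *
    generalize k + 2 + (n : ℝ) = b at *
    generalize k + 3 + (n : ℝ) = c at *
    field_simp
    ring

theorem tsum_cubicTerm_add_three {k : ℝ} (hk : 0 ≤ k) :
    (2 * k + 5) ^ 2 * risingSix (2 * k + 1 / 2) * ∑' n, cubicTerm (k + 3) n
      = 16 * (4 * k + 1) * (4 * k + 7) * risingThree (k + 1) ^ 2 * ∑' n, cubicTerm k n := by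
  have h := (((summable_cubicTerm (k := k + 3) (by positivity)).hasSum.mul_left
    ((2 * k + 5) ^ 2 * risingSix (2 * k + 1 / 2))).sub ((summable_cubicTerm hk).hasSum.mul_left
    (16 * (4 * k + 1) * (4 * k + 7) * risingThree (k + 1) ^ 2))).tendsto_sum_nat
  simp only [cubicTerm_telescope hk] at h
  refine sub_eq_zero.1 (tendsto_nhds_unique h ?_)
  have hz : Tendsto (fun N : ℕ => (N : ℝ) * cubicCertificate k N * (1 / 2) ^ N) atTop (𝓝 0) := by
    have hp := fun d => (summable_pow_mul_half_pow d).tendsto_atTop_zero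
    have := ((((hp 1).const_mul
      (-55 / 2 + 2956 * k + 9194 * k ^ 2 + 9992 * k ^ 3 + 4608 * k ^ 4 + 768 * k ^ 5)).add
      ((hp 2).const_mul (387 + 6260 * k + 12092 * k ^ 2 + 7968 * k ^ 3 + 1728 * k ^ 4))).add
      ((hp 3).const_mul (438 + 3712 * k + 4280 * k ^ 2 + 1312 * k ^ 3))).add
      ((hp 4).const_mul (116 + 656 * k + 336 * k ^ 2))
    simp only [mul_zero, add_zero] at this
    refine this.congr fun N => ?_
    unfold cubicCertificate
    ring
  have hz' := (hz.norm).const_mul (risingThree (k + 1) ^ 2)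
  rw [norm_zero, mul_zero] at hz'
  refine squeeze_zero_norm (fun N => ?_) hz'
  have hc := cubicTerm_nonneg hk N
  have hN : (0 : ℝ) ≤ N := by positivity
  rw [norm_div, norm_mul, Real.norm_of_nonneg (sq_nonneg (risingThree (k + 1))),
    norm_mul _ (cubicTerm k N),
    Real.norm_of_nonneg hc, norm_mul _ ((1 / 2 : ℝ) ^ N),
    Real.norm_of_nonneg (show (0 : ℝ) ≤ (1 / 2) ^ N by positivity)]
  refine (div_le_self (by positivity) ?_).trans ?_
  · rw [Real.norm_of_nonneg (by positivity)]
    refine one_le_pow₀ (one_le_mul_of_one_le_of_one_le ?_ ?_) <;> linarith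
  · gcongr
    exact cubicTerm_le hk N

theorem tsum_cubicTerm_step (j : ℕ) :
    ((1 / 4 + j) * (3 / 4 + j) * (5 / 12 + j) * (11 / 12 + j) * (5 / 6 + j : ℝ) ^ 2)
        * ∑' n, cubicTerm (3 * (j + 1 : ℕ)) n
      = ((1 / 3 + j) ^ 2 * (2 / 3 + j) ^ 2 * (1 + j : ℝ) ^ 2) * ∑' n, cubicTerm (3 * j) n := by
  have h := tsum_cubicTerm_add_three (k := 3 * (j : ℝ)) (by positivity)
  have e : 3 * ((j + 1 : ℕ) : ℝ) = 3 * j + 3 := by push_cast; ring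
  rw [e]
  -- At k = 3j the sixth Pochhammer symbol has factors proportional to j + i/12 for odd i ≤ 11;
  -- those with i = 1, 7 cancel against 4k+1 and 4k+7.
  have hp : (16 * (4 * (3 * j) + 1) * (4 * (3 * j) + 7) * 729 : ℝ) ≠ 0 := by positivity
  refine mul_left_cancel₀ hp ?_
  unfold risingSix risingThree at h
  linear_combination h

theorem tsum_cubicTerm_mul_prod (N : ℕ) :
    (∏ j ∈ range N,
        ((1 / 4 + j) * (3 / 4 + j) * (5 / 12 + j) * (11 / 12 + j) * (5 / 6 + j : ℝ) ^ 2))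
        * ∑' n, cubicTerm (3 * N) n
      = (∏ j ∈ range N, ((1 / 3 + j) ^ 2 * (2 / 3 + j) ^ 2 * (1 + j : ℝ) ^ 2))
        * ∑' n, cubicTerm 0 n := by
  induction N with
  | zero => simp
  | succ N ih =>
    rw [prod_range_succ, prod_range_succ, mul_assoc, tsum_cubicTerm_step, mul_left_comm, ih]
    ring

theorem tsum_cubicTerm_eq_gammaSeq (n : ℕ) (hn : n ≠ 0) :
    ∑' i, cubicTerm 0 i * (Real.GammaSeq (1 / 4) n * Real.GammaSeq (3 / 4) n
        * (Real.GammaSeq (5 / 12) n * Real.GammaSeq (11 / 12) n) * Real.GammaSeq (5 / 6) n ^ 2)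
      = (∑' i, cubicTerm (3 * (n + 1 : ℕ)) i) * ((Real.GammaSeq (1 / 3) n
        * Real.GammaSeq (2 / 3) n) ^ 2 * Real.GammaSeq 1 n ^ 2) := by
  -- The product in `Real.GammaSeq s n` has n + 1 factors.
  have h := tsum_cubicTerm_mul_prod (n + 1)
  have hpos : ∀ s : ℝ, 0 < s → ∏ j ∈ range (n + 1), (s + j) ≠ 0 := fun s hs =>
    (prod_pos fun j _ => by positivity).ne'
  -- All gamma arguments are multiples of 1/12, so every power of n is a natural power of X =
  -- n^(1/12). The arguments sum to 4 on both sides, so both carry X^48.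
  have hpow : ∀ m : ℕ, (n : ℝ) ^ ((1 / 12 : ℝ) * m) = ((n : ℝ) ^ (1 / 12 : ℝ)) ^ m := fun m =>
    Real.rpow_mul_natCast (by positivity) _ _
  have p3 := hpow 3
  have p9 := hpow 9
  have p5 := hpow 5
  have p11 := hpow 11
  have p10 := hpow 10
  have p4 := hpow 4
  have p8 := hpow 8
  have p12 := hpow 12
  norm_num at p3 p9 p5 p11 p10 p4 p8 p12
  have q1 := hpos (1 / 4) (by norm_num)
  have q2 := hpos (3 / 4) (by norm_num)
  have q3 := hpos (5 / 12) (by norm_num)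
  have q4 := hpos (11 / 12) (by norm_num)
  have q5 := hpos (5 / 6) (by norm_num)
  have q6 := hpos (1 / 3) (by norm_num)
  have q7 := hpos (2 / 3) (by norm_num)
  have q8 := hpos 1 (by norm_num)
  simp only [prod_mul_distrib, prod_pow] at h
  rw [tsum_mul_right]
  simp only [Real.GammaSeq, p3, p9, p5, p11, p10, p4, p8]
  rw [Real.rpow_one]
  generalize ∏ j ∈ range (n + 1), ((1 / 4 : ℝ) + j) = a1 at *
  generalize ∏ j ∈ range (n + 1), ((3 / 4 : ℝ) + j) = a2 at *
  generalize ∏ j ∈ range (n + 1), ((5 / 12 : ℝ) + j) = a3 at *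
  generalize ∏ j ∈ range (n + 1), ((11 / 12 : ℝ) + j) = a4 at *
  generalize ∏ j ∈ range (n + 1), ((5 / 6 : ℝ) + j) = a5 at *
  generalize ∏ j ∈ range (n + 1), ((1 / 3 : ℝ) + j) = a6 at *
  generalize ∏ j ∈ range (n + 1), ((2 / 3 : ℝ) + j) = a7 at *
  generalize ∏ j ∈ range (n + 1), ((1 : ℝ) + j) = a8 at *
  generalize (n : ℝ) ^ (1 / 12 : ℝ) = X at *
  rw [p12]
  generalize (Nat.factorial n : ℝ) = F at *
  generalize (∑' i, cubicTerm (3 * (n + 1 : ℕ)) i) = S at *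
  generalize (∑' i, cubicTerm 0 i) = T at *
  field_simp
  linear_combination (-(X ^ 48 * F ^ 6)) * h

theorem tsum_cubicTerm_zero_mul_gamma :
    (∑' n, cubicTerm 0 n) * (Real.Gamma (1 / 4) * Real.Gamma (3 / 4)
        * (Real.Gamma (5 / 12) * Real.Gamma (11 / 12)) * Real.Gamma (5 / 6) ^ 2)
      = (Real.Gamma (1 / 3) * Real.Gamma (2 / 3)) ^ 2 := by
  have hG := Real.GammaSeq_tendsto_Gamma
  have hS : Tendsto (fun n : ℕ => ∑' i, cubicTerm (3 * (n + 1 : ℕ)) i) atTop (𝓝 1) := by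
    refine tendsto_tsum_cubicTerm _ fun j => ?_
    have : (0 : ℝ) ≤ j := by positivity
    push_cast
    linarith
  have h1 := ((((hG (1 / 4)).mul (hG (3 / 4))).mul ((hG (5 / 12)).mul (hG (11 / 12)))).mul
    ((hG (5 / 6)).pow 2)).const_mul (∑' n, cubicTerm 0 n)
  have h2 := hS.mul ((((hG (1 / 3)).mul (hG (2 / 3))).pow 2).mul ((hG 1).pow 2))
  rw [Real.Gamma_one, one_pow, mul_one, one_mul] at h2
  refine tendsto_nhds_unique h1 (h2.congr' ?_)
  filter_upwards [eventually_ne_atTop 0] with n hn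
  rw [← tsum_cubicTerm_eq_gammaSeq n hn, tsum_mul_right]

/-! ### Reflection and duplication, and the final values -/

theorem gamma_one_fourth_mul_gamma_three_fourths :
    Real.Gamma (1 / 4) * Real.Gamma (3 / 4) = Real.pi * Real.sqrt 2 := by
  have h := Real.Gamma_mul_Gamma_one_sub (1 / 4)
  rw [show (1 - 1 / 4 : ℝ) = 3 / 4 by norm_num, show Real.pi * (1 / 4) = Real.pi / 4 by ring,
    Real.sin_pi_div_four] at h
  rw [h]
  have h2 : Real.sqrt 2 * Real.sqrt 2 = 2 := Real.mul_self_sqrt (by norm_num)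
  field_simp
  linarith

theorem gamma_one_third_mul_gamma_two_thirds_sq :
    (Real.Gamma (1 / 3) * Real.Gamma (2 / 3)) ^ 2 = 4 * Real.pi ^ 2 / 3 := by
  have h := Real.Gamma_mul_Gamma_one_sub (1 / 3)
  rw [show (1 - 1 / 3 : ℝ) = 2 / 3 by norm_num, show Real.pi * (1 / 3) = Real.pi / 3 by ring,
    Real.sin_pi_div_three] at h
  rw [h, div_pow, div_pow, Real.sq_sqrt (by norm_num)]
  ring

theorem gamma_five_twelfths_mul_gamma_eleven_twelfths :
    Real.Gamma (5 / 12) * Real.Gamma (11 / 12)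
      = Real.Gamma (5 / 6) * (2 : ℝ) ^ (1 / 6 : ℝ) * Real.sqrt Real.pi := by
  have h := Real.Gamma_mul_Gamma_add_half (5 / 12)
  norm_num at h ⊢
  exact h

theorem tsum_cubicTerm_zero :
    ∑' n, cubicTerm 0 n
      = 2 * (2 : ℝ) ^ (1 / 3 : ℝ) / 3 * (Real.sqrt Real.pi / Real.Gamma (5 / 6 : ℝ) ^ 3) := by
  have h := tsum_cubicTerm_zero_mul_gamma
  rw [gamma_one_fourth_mul_gamma_three_fourths, gamma_one_third_mul_gamma_two_thirds_sq,
    gamma_five_twelfths_mul_gamma_eleven_twelfths] at h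
  have hg : Real.Gamma (5 / 6) ≠ 0 := (Real.Gamma_pos_of_pos (by norm_num)).ne'
  have hpi := Real.pi_pos
  -- The powers of 2 from reflection at 1/4 and duplication at 5/12 combine to 2^(2/3), which
  -- 2^(1/3) clears from the denominator.
  have h2 : Real.sqrt 2 * (2 : ℝ) ^ (1 / 6 : ℝ) * (2 : ℝ) ^ (1 / 3 : ℝ) = 2 := by
    rw [Real.sqrt_eq_rpow, ← Real.rpow_add (by norm_num), ← Real.rpow_add (by norm_num)]
    norm_num
  have hs : Real.sqrt Real.pi ^ 2 = Real.pi := Real.sq_sqrt hpi.le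
  have hs0 : Real.sqrt Real.pi ≠ 0 := (Real.sqrt_pos.2 hpi).ne'
  generalize Real.Gamma (5 / 6) = g at *
  generalize Real.sqrt Real.pi = s at *
  generalize (2 : ℝ) ^ (1 / 3 : ℝ) = c at *
  generalize (2 : ℝ) ^ (1 / 6 : ℝ) = d at *
  generalize ∑' n, cubicTerm 0 n = T at *
  rw [← hs] at h
  have h3 : T * (Real.sqrt 2 * d) * g ^ 3 = 4 * s / 3 := by
    refine mul_left_cancel₀ (pow_ne_zero 3 hs0) ?_
    linear_combination h
  rw [div_mul_div_comm, eq_div_iff (by positivity)]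
  linear_combination (3 / 2 * c) * h3 - (3 / 2 * T * g ^ 3) * h2

theorem mainTheorem3 :
    HasSum
      (fun n : ℕ => ((ascPochhammer ℝ n).eval (1 / 2 : ℝ)) ^ 3 / (Nat.factorial n : ℝ) ^ 3
        * (1 + 6 * (n : ℝ)) * (1 / (2 : ℝ) ^ (2 * n)))
      (4 / Real.pi) ∧
    HasSum
      (fun n : ℕ => ((ascPochhammer ℝ n).eval (1 / 2 : ℝ)) ^ 3 / (Nat.factorial n : ℝ) ^ 3
        * (1 / (4 : ℝ) ^ n))
      (2 * (2 : ℝ) ^ (1 / 3 : ℝ) / 3 * (Real.sqrt Real.pi / Real.Gamma (5 / 6 : ℝ) ^ 3)) := by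
  constructor
  · have h := (summable_balancedTerm_mul le_rfl).hasSum
    simp only [mul_zero, add_zero] at h
    rw [tsum_balancedTerm_zero] at h
    convert h using 2 with n
    rw [balancedTerm_zero_left, pow_mul]
    norm_num
    ring
  · have h := (summable_cubicTerm le_rfl).hasSum
    rw [tsum_cubicTerm_zero] at h
    simpa only [funext cubicTerm_zero_left, funext balancedTerm_zero_left] using h
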